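/- For a power series $f=\sum_{m\ge 0} f_m x^m$ over a field, let $H(f)=(H_0(f),H_1(f),H_2(f),\dots)$ be its sequence of Hankel determinants, where $H_n(f)=\det(f_{i+j})_{0\le i,j\le n-1}$ and $H_0(f)=1$. For integers $a,b\ge 0$ let $$G_{a,b}(x)=\frac{1}{x^{2^a}}\sum_{n=0}^{\infty}\frac{x^{2^{n+a}}}{1-x^{2^{n+b}}}\in\mathbb F_2[[x]].$$ Write $u,(v)^*$ for the sequence consisting of the finite word $u$ followed by infinitely many repetitions of the word $v$, and in words let $c^{k}$ stand for $k$ consecutive entries equal to $c$. Then over $\mathbb F_2$ $$\begin{aligned} H(G_{0,0})&=(1)^* ;\\ H(G_{0,1})&=1,1,(0)^* ;\\ H(G_{1,0})&=(1)^* ;\\ H(G_{0,2})&=(1,1,1,0,0,1,0,0,1,1)^* ;\\ H(G_{1,1})&=(1,1,0,0,1,1)^* ;\\ H(G_{2,0})&=(1,1,0,0)^* ;\\ H(G_{0,3})&=( 1^{5} 0^{2} 1^{1} 0^{6} 1^{3} 0^{2} 1^{2} 0^{2} 1^{2} 0^{4} 1^{1} 0^{4} 1^{1} 0^{2} 1^{1}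 0^{2} 1^{1} 0^{4} 1^{1} 0^{4} 1^{2} 0^{2} 1^{2} 0^{2} 1^{3} 0^{6} 1^{1} 0^{2} 1^{4})^*\quad\text{(least period }74) ;\\ H(G_{1,2})&=1,1,1,(0)^* ;\\ H(G_{2,1})&=(1,1,1,1,1,1,0,0)^* ;\\ H(G_{3,0})&=(1,1,0,0,0,0,0,0)^* ;\\ H(G_{0,4})&=(1^{9}0^{2}1^{1}0^{2}\cdots 1^{1}0^{2}1^{8})^*=(w)^*\quad\text{(least period }1078) ;\\ H(G_{1,3})&=(1,1,1,1,1,0,0,0,0,1,1,0,0,0,0,1,1,1,1,1)^* ;\\ H(G_{2,2})&=(1,1,0,0,0,0,0,0,1,1,0,0)^* ;\\ H(G_{3,1})&=(1,1,1,0,0,0,0,1,1,1,0,0,0,0,0,0)^* ;\\ H(G_{4,0})&=(1,1,0,0,0,0,0,0,0,0,0,0,0,0,0,0)^* . \end{aligned}$$ Here $w=1^{k_1}0^{k_2}1^{k_3}0^{k_4}\cdots 0^{k_{364}}1^{k_{365}}$ is the word of length $1078$ whose runs of $1$s and $0$s alternate, starting with $1$s, and have the lengths $(k_1,\dots,k_{365})$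 equal to 9, 2, 1, 2, 1, 2, 1, 2, 3, 2, 1, 2, 2, 4, 3, 2, 3, 4, 1, 4, 1, 2, 6, 6, 1, 2, 1, 4, 1, 2, 1, 4, 4, 2, 5, 2, 1, 6, 1, 2, 1, 4, 2, 8, 2, 2, 2, 4, 1, 8, 1, 8, 1, 6, 1, 6, 1, 2, 1, 2, 1, 4, 3, 8, 1, 6, 2, 4, 2, 2, 1, 2, 1, 4, 1, 12, 1, 2, 1, 2, 1, 4, 1, 2, 1, 4, 5, 12, 1, 2, 3, 2, 2, 2, 2, 2, 2, 2, 3, 14, 1, 2, 2, 2, 6, 2, 4, 4, 1, 10, 3, 2, 1, 4, 3, 6, 2, 4, 1, 10, 1, 6, 2, 4, 1, 4, 1, 8, 1, 6, 3, 6, 3, 2, 2, 4, 2, 6, 2, 6, 2, 8, 2, 2, 1, 2, 2, 2, 1, 6, 4, 2, 1, 4, 1, 4, 2, 2, 1, 2, 4, 2, 3, 2, 2, 2, 2, 2, 2, 2, 2, 4, 3, 2, 5, 4, 2, 2, 1, 2, 1, 2, 1, 2, 1, 2, 1, 2, 2, 4, 5, 2, 3, 4, 2, 2, 2, 2, 2,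 2, 2, 2, 3, 2, 4, 2, 1, 2, 2, 4, 1, 4, 1, 2, 4, 6, 1, 2, 2, 2, 1, 2, 2, 8, 2, 6, 2, 6, 2, 4, 2, 2, 3, 6, 3, 6, 1, 8, 1, 4, 1, 4, 2, 6, 1, 10, 1, 4, 2, 6, 3, 4, 1, 2, 3, 10, 1, 4, 4, 2, 6, 2, 2, 2, 1, 14, 3, 2, 2, 2, 2, 2, 2, 2, 3, 2, 1, 12, 5, 4, 1, 2, 1, 4, 1, 2, 1, 2, 1, 12, 1, 4, 1, 2, 1, 2, 2, 4, 2, 6, 1, 8, 3, 4, 1, 2, 1, 2, 1, 6, 1, 6, 1, 8, 1, 8, 1, 4, 2, 2, 2, 8, 2, 4, 1, 2, 1, 6, 1, 2, 5, 2, 4, 4, 1, 2, 1, 4, 1, 2, 1, 6, 6, 2, 1, 4, 1, 4, 3, 2, 3, 4, 2, 2, 1, 2, 3, 2, 1, 2, 1, 2, 1, 2, 8. -/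

import Mathlib

open PowerSeries

/-- The `n`-th summand `x^(2^(n+a)) / (1 - x^(2^(n+b)))` as a formal power series over `F_2`.
The denominator has constant coefficient `1`, so `⁻¹` is its true inverse. -/
noncomputable def gTerm (a b n : ℕ) : PowerSeries (ZMod 2) :=
  X ^ (2 ^ (n + a)) * (1 - X ^ (2 ^ (n + b)))⁻¹

/-- The denominator of a summand is invertible, with the inverse used in `gTerm`. -/
theorem gTerm_mul_denom (a b n : ℕ) :
    gTerm a b n * (1 - X ^ (2 ^ (n + b))) = X ^ (2 ^ (n + a)) := by
  unfold gTerm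
  rw [mul_assoc, PowerSeries.inv_mul_cancel, mul_one]
  simp

theorem coeff_gTerm_eq_zero (a b n m : ℕ) (h : m < 2 ^ (n + a)) :
    coeff m (gTerm a b n) = 0 := by
  unfold gTerm
  rw [coeff_X_pow_mul', if_neg (by omega)]

/-- In each degree only finitely many summands contribute, so the formal infinite sum converges. -/
theorem finite_support_coeff_gTerm (a b m : ℕ) :
    (Function.support fun n => coeff m (gTerm a b n)).Finite := by
  refine (Set.finite_Iio (m + 1)).subset fun n hn => ?_
  by_contra h
  refine hn (coeff_gTerm_eq_zero a b n m ?_)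
  have h1 : m + 1 ≤ n := by simpa using h
  calc m < n := h1
    _ < 2 ^ n := Nat.lt_two_pow_self
    _ ≤ 2 ^ (n + a) := Nat.pow_le_pow_right (by norm_num) (by omega)

/-- The formal infinite sum `∑_{n ≥ 0} x^(2^(n+a)) / (1 - x^(2^(n+b)))`, computed coefficientwise. -/
noncomputable def gSum (a b : ℕ) : PowerSeries (ZMod 2) :=
  PowerSeries.mk fun m => ∑ᶠ n, coeff m (gTerm a b n)

/-- The power series `G_{a,b}(x) = x^(-2^a) ∑_{n ≥ 0} x^(2^(n+a)) / (1 - x^(2^(n+b)))` over `F_2`. -/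
noncomputable def G (a b : ℕ) : PowerSeries (ZMod 2) :=
  PowerSeries.mk fun m => coeff (m + 2 ^ a) (gSum a b)

/-- `G a b` is the quotient of `gSum a b` by `x^(2^a)`. -/
theorem X_pow_mul_G (a b : ℕ) : X ^ (2 ^ a) * G a b = gSum a b := by
  ext m
  rw [coeff_X_pow_mul']
  split_ifs with h
  · rw [G, coeff_mk, Nat.sub_add_cancel h]
  · rw [gSum, coeff_mk, finsum_eq_zero_of_forall_eq_zero]
    intro n
    refine coeff_gTerm_eq_zero a b n m (lt_of_lt_of_le (not_le.mp h) ?_)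
    exact Nat.pow_le_pow_right (by norm_num) (by omega)

/-- The Hankel determinant `H_n(f) = det (f_{i+j})_{0 ≤ i, j < n}`; in particular `H_0(f) = 1`.
As a function of `n` this is the sequence `H(f)` of Hankel determinants. -/
noncomputable def hankelDet {R : Type*} [CommRing R] (f : PowerSeries R) (n : ℕ) : R :=
  Matrix.det (Matrix.of fun i j : Fin n => coeff ((i : ℕ) + (j : ℕ)) f)

/-- The ultimately periodic sequence `pre, (per)^*`: the entries of `pre` followed by
infinitely many repetitions of the (nonempty) word `per`. -/
def starSeq {R : Type*} [Zero R] (pre per : List R) (n : ℕ) : R :=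
  if n < pre.length then pre.getD n 0 else per.getD ((n - pre.length) % per.length) 0

/-- `runs c [k₁, k₂, k₃, …]` is the binary word `c^{k₁} (c+1)^{k₂} c^{k₃} …`. -/
def runs : ZMod 2 → List ℕ → List (ZMod 2)
  | _, [] => []
  | c, k :: ks => List.replicate k c ++ runs (c + 1) ks

/-- The word `1^5 0^2 1^1 0^6 ⋯ 0^2 1^4` of length 74. -/
def word03 : List (ZMod 2) := runs 1
  [5, 2, 1, 6, 3, 2, 2, 2, 2, 4, 1, 4, 1, 2, 1, 2, 1, 4, 1, 4, 2, 2, 2, 2, 3, 6, 1, 2, 4]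

/-- The word `1^9 0^2 1^1 0^2 ⋯ 1^1 0^2 1^8` of length 1078. -/
def word04 : List (ZMod 2) := runs 1
  [9, 2, 1, 2, 1, 2, 1, 2, 3, 2, 1, 2, 2, 4, 3, 2, 3, 4, 1, 4, 1, 2, 6, 6, 1, 2, 1, 4, 1, 2,
   1, 4, 4, 2, 5, 2, 1, 6, 1, 2, 1, 4, 2, 8, 2, 2, 2, 4, 1, 8, 1, 8, 1, 6, 1, 6, 1, 2, 1, 2,
   1, 4, 3, 8, 1, 6, 2, 4, 2, 2, 1, 2, 1, 4, 1, 12, 1, 2, 1, 2, 1, 4, 1, 2, 1, 4, 5, 12, 1,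
   2, 3, 2, 2, 2, 2, 2, 2, 2, 3, 14, 1, 2, 2, 2, 6, 2, 4, 4, 1, 10, 3, 2, 1, 4, 3, 6, 2, 4,
   1, 10, 1, 6, 2, 4, 1, 4, 1, 8, 1, 6, 3, 6, 3, 2, 2, 4, 2, 6, 2, 6, 2, 8, 2, 2, 1, 2, 2,
   2, 1, 6, 4, 2, 1, 4, 1, 4, 2, 2, 1, 2, 4, 2, 3, 2, 2, 2, 2, 2, 2, 2, 2, 4, 3, 2, 5, 4, 2,
   2, 1, 2, 1, 2, 1, 2, 1, 2, 1, 2, 2, 4, 5, 2, 3, 4, 2, 2, 2, 2, 2, 2, 2, 2, 3, 2, 4, 2, 1,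
   2, 2, 4, 1, 4, 1, 2, 4, 6, 1, 2, 2, 2, 1, 2, 2, 8, 2, 6, 2, 6, 2, 4, 2, 2, 3, 6, 3, 6, 1,
   8, 1, 4, 1, 4, 2, 6, 1, 10, 1, 4, 2, 6, 3, 4, 1, 2, 3, 10, 1, 4, 4, 2, 6, 2, 2, 2, 1, 14,
   3, 2, 2, 2, 2, 2, 2, 2, 3, 2, 1, 12, 5, 4, 1, 2, 1, 4, 1, 2, 1, 2, 1, 12, 1, 4, 1, 2, 1,
   2, 2, 4, 2, 6, 1, 8, 3, 4, 1, 2, 1, 2, 1, 6, 1, 6, 1, 8, 1, 8, 1, 4, 2, 2, 2, 8, 2, 4, 1,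
   2, 1, 6, 1, 2, 5, 2, 4, 4, 1, 2, 1, 4, 1, 2, 1, 6, 6, 2, 1, 4, 1, 4, 3, 2, 3, 4, 2, 2, 1,
   2, 3, 2, 1, 2, 1, 2, 1, 2, 8]

/-! Squaring over `F_2` sends each summand of `gSum` to the next, so the sum telescopes to a
quadratic equation for `G a b` (`G_quadratic`). A root f of A f² + B f = C, with A(0) = 0 and B(0) =
1, expands as f = x^k / (u + x^(k+2) g), where x^k exactly divides C, deg u ≤ k + 1 and u(0) = 1.
The remainder g again satisfies such an equation, with the same B (`IsRoot.exists_of_isStep`).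

One such step puts the word 1 0^k in front of the Hankel determinants of g. By Padé approximation,
vanishing of the determinants shifts by k + 1 (`hankelDet_eq_zero_iff_of_mul_eq`), and over `F_2`
vanishing determines the value.

The pair (A, C) determines its root (`IsRoot.unique`), so a repeated pair makes the determinants
periodic, while C = 0 ends the expansion. Both are finite computations with polynomials stored as
binary numbers. -/

/-! ### Hankel determinants and Padé approximation -/

/-- A power series that is a polynomial of degree less than `n`. -/
def DegLT {R : Type*} [Semiring R] (q : PowerSeries R) (n : ℕ) : Prop :=
  ∀ i, n ≤ i → coeff i q = 0

theorem DegLT.eq_zero_of_dvd {R : Type*} [CommRing R] {q : PowerSeries R} {n N : ℕ}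
    (hq : DegLT q n) (hN : n ≤ N) (h : X ^ N ∣ q) : q = 0 := by
  ext i
  rcases lt_or_ge i n with hi | hi
  · simpa using X_pow_dvd_iff.1 h i (by omega)
  · simpa using hq i hi

theorem DegLT.mul {R : Type*} [CommRing R] {p q : PowerSeries R} {m n : ℕ}
    (hp : DegLT p m) (hq : DegLT q (n + 1)) : DegLT (p * q) (m + n) := by
  intro i hi
  rw [coeff_mul]
  refine Finset.sum_eq_zero fun x hx => ?_
  have hx := Finset.HasAntidiagonal.mem_antidiagonal.1 hx
  rcases lt_or_ge x.1 m with h | h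
  · rw [hq x.2 (by omega), mul_zero]
  · rw [hp x.1 h, zero_mul]

theorem DegLT.add {R : Type*} [CommRing R] {p q : PowerSeries R} {n : ℕ}
    (hp : DegLT p n) (hq : DegLT q n) : DegLT (p + q) n := fun i hi => by
  rw [map_add, hp i hi, hq i hi, add_zero]

theorem DegLT.sub {R : Type*} [CommRing R] {p q : PowerSeries R} {n : ℕ}
    (hp : DegLT p n) (hq : DegLT q n) : DegLT (p - q) n := fun i hi => by
  rw [map_sub, hp i hi, hq i hi, sub_zero]

theorem degLT_X_pow_mul_iff {R : Type*} [CommRing R] {q : PowerSeries R} {m k : ℕ} :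
    DegLT (X ^ k * q) (m + k) ↔ DegLT q m := by
  refine ⟨fun h i hi => ?_, fun h i hi => ?_⟩
  · rw [← coeff_X_pow_mul q k i]
    exact h _ (by omega)
  · rw [coeff_X_pow_mul']
    split_ifs
    · exact h _ (by omega)
    · rfl

/-- Reversing the coefficients of `q` turns convolution with `f` into multiplication by row `i` of
the Hankel matrix. -/
theorem coeff_mul_eq_hankel_sum {R : Type*} [CommRing R] (f q : PowerSeries R) (n : ℕ)
    (hq : DegLT q (n + 1)) (i : ℕ) :
    coeff (n + i) (q * f) = ∑ j : Fin (n + 1), coeff (i + j) f * coeff (n - j) q := by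
  rw [coeff_mul, Finset.Nat.sum_antidiagonal_eq_sum_range_succ
    (fun a b => coeff a q * coeff b f),
    Fin.sum_univ_eq_sum_range (fun j => coeff (i + j) f * coeff (n - j) q),
    ← Finset.sum_range_reflect (fun j => coeff (i + j) f * coeff (n - j) q),
    ← Finset.sum_subset (Finset.range_mono (show n + 1 ≤ (n + i).succ by omega))
      (fun j _ hj => by rw [hq j (by simpa using hj), zero_mul])]
  refine Finset.sum_congr rfl fun j hj => ?_
  rw [Finset.mem_range] at hj
  rw [mul_comm, show n - (n + 1 - 1 - j) = j by omega, show i + (n + 1 - 1 - j) = n + i - j by omega]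

/-- The `n`-th Hankel determinant vanishes iff there is a Padé approximant `p / q` of `X f`
with `p` and `q` of degree less than `n` and contact of order `2 n`. -/
theorem hankelDet_eq_zero_iff {K : Type*} [Field K] (f : PowerSeries K) (n : ℕ) :
    hankelDet f n = 0 ↔ ∃ q p : PowerSeries K, q ≠ 0 ∧ DegLT q n ∧ DegLT p n ∧
      X ^ (2 * n) ∣ X * q * f - p := by
  rcases n with _ | n
  · simp only [hankelDet, Matrix.det_isEmpty, one_ne_zero, false_iff]
    rintro ⟨q, p, h0, hq, -⟩
    exact h0 (by ext i; simpa using hq i (Nat.zero_le i))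
  rw [hankelDet, ← Matrix.exists_mulVec_eq_zero_iff]
  constructor
  · rintro ⟨v, hv, hM⟩
    set q : PowerSeries K := mk fun i => if h : i < n + 1 then v ⟨n - i, by omega⟩ else 0 with hqd
    have hq : DegLT q (n + 1) := fun i hi => by
      rw [hqd, coeff_mk, dif_neg (by omega)]
    have hqv : ∀ j : Fin (n + 1), coeff (n - j) q = v j := fun j => by
      rw [hqd, coeff_mk, dif_pos (by omega)]
      congr 1
      ext
      simp only
      omega
    refine ⟨q, mk fun i => if i < n + 1 then coeff i (X * q * f) else 0, ?_, hq, ?_, ?_⟩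
    · intro h0
      refine hv (funext fun j => ?_)
      rw [← hqv j, h0]
      simp
    · intro i hi
      rw [coeff_mk, if_neg (by omega)]
    · rw [X_pow_dvd_iff]
      intro i hi
      rw [map_sub, coeff_mk]
      split_ifs with h
      · exact sub_self _
      · obtain ⟨l, rfl⟩ : ∃ l, i = n + l + 1 := ⟨i - n - 1, by omega⟩
        rw [sub_zero, mul_assoc, coeff_succ_X_mul, coeff_mul_eq_hankel_sum f q n hq]
        have := congrFun hM ⟨l, by omega⟩
        simpa [Matrix.mulVec, dotProduct, hqv] using this
  · rintro ⟨q, p, h0, hq, hp, hd⟩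
    refine ⟨fun j => coeff (n - j) q, fun hv => h0 ?_, ?_⟩
    · ext i
      rcases lt_or_ge i (n + 1) with hi | hi
      · have := congrFun hv ⟨n - i, by omega⟩
        simpa [show n - (n - i) = i by omega] using this
      · simpa using hq i hi
    · funext l
      have h1 := X_pow_dvd_iff.1 hd (n + l + 1) (by omega)
      rw [map_sub, hp _ (by omega), sub_zero, mul_assoc, coeff_succ_X_mul,
        coeff_mul_eq_hankel_sum f q n hq] at h1
      simpa [Matrix.mulVec, dotProduct] using h1

theorem hankelDet_zero {R : Type*} [CommRing R] (f : PowerSeries R) : hankelDet f 0 = 1 := by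
  simp [hankelDet]

theorem hankelDet_eq_zero_of_X_pow_dvd {R : Type*} [CommRing R] (f : PowerSeries R) {n k : ℕ}
    (h : X ^ k ∣ f) (hn : 0 < n) (hk : n ≤ k) : hankelDet f n = 0 := by
  refine Matrix.det_eq_zero_of_row_eq_zero ⟨0, hn⟩ fun j => ?_
  simpa using X_pow_dvd_iff.1 h j (by omega)

/-- One step of the Hankel continued fraction expansion shifts the vanishing of Hankel
determinants by `k + 1`. -/
theorem hankelDet_eq_zero_iff_of_mul_eq {K : Type*} [Field K] {f g u : PowerSeries K} {k : ℕ}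
    (hu0 : constantCoeff u ≠ 0) (hu : DegLT u (k + 2))
    (h : f * (u + X ^ (k + 2) * g) = X ^ k) (m : ℕ) :
    hankelDet f (m + (k + 1)) = 0 ↔ hankelDet g m = 0 := by
  have hD : IsUnit (u + X ^ (k + 2) * g) := by
    rw [isUnit_iff_constantCoeff]
    simpa using hu0
  have hX : ∀ n : ℕ, (X ^ n : PowerSeries K) ≠ 0 := fun n => pow_ne_zero n X_ne_zero
  rw [hankelDet_eq_zero_iff, hankelDet_eq_zero_iff]
  constructor
  -- Approximants (q, p) of X f and (p', r) of X g correspond via p = X^(k+1) p', q = p' u + X^(k+1)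
  -- r. Multiplying the contact condition by the unit u + X^(k+2) g replaces f by X^k.
  · rintro ⟨q, p, h0, hq, hp, hd⟩
    have h1 : X ^ (2 * (m + (k + 1))) ∣ X ^ (k + 1) * q - p * (u + X ^ (k + 2) * g) := by
      convert hd.mul_right (u + X ^ (k + 2) * g) using 1
      linear_combination (-X * q) * h
    have h2 : X ^ (k + 1) ∣ p := by
      rw [← hD.dvd_mul_right]
      have := (pow_dvd_pow (X : PowerSeries K) (show k + 1 ≤ 2 * (m + (k + 1)) by omega)).trans h1
      exact (dvd_sub_right (Dvd.intro _ rfl)).1 this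
    obtain ⟨p', rfl⟩ := h2
    have h3 : X ^ (2 * m + (k + 1)) ∣ q - p' * (u + X ^ (k + 2) * g) := by
      rw [← mul_dvd_mul_iff_left (hX (k + 1))]
      convert h1 using 1 <;> ring
    have h4 : X ^ (k + 1) ∣ q - p' * u := by
      have := (pow_dvd_pow (X : PowerSeries K) (show k + 1 ≤ 2 * m + (k + 1) by omega)).trans h3
      convert this.add (Dvd.intro (X * g * p') rfl) using 1
      ring
    obtain ⟨r, hr⟩ := h4
    have hp' : DegLT p' m := degLT_X_pow_mul_iff.1 hp
    refine ⟨p', r, ?_, hp', ?_, ?_⟩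
    · rintro rfl
      refine h0 (hq.eq_zero_of_dvd (N := 2 * m + (k + 1)) (by omega) ?_)
      simpa using h3
    · refine (degLT_X_pow_mul_iff (k := k + 1)).1 ?_
      rw [← hr]
      exact hq.sub (hp'.mul hu)
    · rw [← mul_dvd_mul_iff_left (hX (k + 1)), ← dvd_neg]
      convert h3 using 1
      · ring
      · linear_combination -hr
  · rintro ⟨p', r, h0, hp', hr, hd⟩
    have h3 : X ^ (2 * (m + (k + 1))) ∣
        X * (p' * u + X ^ (k + 1) * r) * f - X ^ (k + 1) * p' := by
      rw [← hD.dvd_mul_right, ← dvd_neg]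
      have := mul_dvd_mul_left (X ^ (2 * (k + 1))) hd
      convert this using 1
      · ring
      · linear_combination (-X * (p' * u + X ^ (k + 1) * r)) * h
    have hp : DegLT (X ^ (k + 1) * p') (m + (k + 1)) := degLT_X_pow_mul_iff.2 hp'
    refine ⟨p' * u + X ^ (k + 1) * r, X ^ (k + 1) * p', fun hq => ?_,
      (hp'.mul hu).add (degLT_X_pow_mul_iff.2 hr), hp, h3⟩
    rw [hq, mul_zero, zero_mul, zero_sub, dvd_neg] at h3
    exact mul_ne_zero (hX _) h0 (hp.eq_zero_of_dvd (by omega) h3)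

/-! ### Binary polynomials encoded as natural numbers -/

theorem two_eq_zero_powerSeries : (2 : PowerSeries (ZMod 2)) = 0 :=
  (map_ofNat (PowerSeries.C (R := ZMod 2)) 2).symm.trans
    ((congrArg _ CharTwo.two_eq_zero).trans (map_zero _))

/-- The polynomial over `F_2` whose coefficients are the binary digits of `n`. -/
def bitSeries (n : ℕ) : PowerSeries (ZMod 2) :=
  mk fun i => if n.testBit i then 1 else 0

theorem bitSeries_xor (a b : ℕ) : bitSeries (a ^^^ b) = bitSeries a + bitSeries b := by
  ext i
  simp only [bitSeries, coeff_mk, map_add, Nat.testBit_xor]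
  cases a.testBit i <;> cases b.testBit i <;> decide

theorem bitSeries_shiftLeft (a k : ℕ) : bitSeries (a <<< k) = X ^ k * bitSeries a := by
  ext i
  rw [coeff_X_pow_mul']
  simp only [bitSeries, coeff_mk, Nat.testBit_shiftLeft]
  by_cases h : k ≤ i <;> simp [h]

theorem bitSeries_zero : bitSeries 0 = 0 := by
  ext i
  simp [bitSeries]

theorem bitSeries_one : bitSeries 1 = 1 := by
  ext i
  rcases i with _ | i <;> simp [bitSeries, coeff_one, Nat.testBit_succ]

theorem constantCoeff_bitSeries (n : ℕ) :
    constantCoeff (bitSeries n) = if n.testBit 0 then 1 else 0 := by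
  rw [← coeff_zero_eq_constantCoeff_apply, bitSeries, coeff_mk]

theorem degLT_bitSeries {n k : ℕ} (h : n < 2 ^ k) : DegLT (bitSeries n) k := fun i hi => by
  rw [bitSeries, coeff_mk, Nat.testBit_lt_two_pow (h.trans_le (Nat.pow_le_pow_right two_pos hi))]
  simp

theorem bitSeries_eq_div_two (n : ℕ) :
    bitSeries n = (if n.testBit 0 then 1 else 0) + X * bitSeries (n / 2) := by
  ext i
  rcases i with _ | i
  · by_cases h : n.testBit 0 <;> simp [bitSeries, h]
  · rw [map_add, coeff_succ_X_mul]
    by_cases h : n.testBit 0 <;> simp [bitSeries, Nat.testBit_succ, h, coeff_one]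

/-- Carry-less multiplication of `a < 2 ^ fuel` with `b`. -/
def clMulAux : ℕ → ℕ → ℕ → ℕ
  | 0, _, _ => 0
  | fuel + 1, a, b => (bif a.testBit 0 then b else 0) ^^^ clMulAux fuel (a / 2) (b <<< 1)

/-- Carry-less multiplication. -/
def clMul (a b : ℕ) : ℕ := clMulAux (a.log2 + 1) a b

theorem bitSeries_clMulAux (fuel a b : ℕ) (h : a < 2 ^ fuel) :
    bitSeries (clMulAux fuel a b) = bitSeries a * bitSeries b := by
  induction fuel generalizing a b with
  | zero =>
    obtain rfl : a = 0 := by simpa using h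
    simp [clMulAux, bitSeries_zero]
  | succ fuel ih =>
    rw [clMulAux, bitSeries_xor, ih _ _ (by rw [pow_succ] at h; omega), bitSeries_shiftLeft,
      bitSeries_eq_div_two a]
    cases a.testBit 0
    · simp [bitSeries_zero]
      ring
    · simp
      ring

theorem bitSeries_clMul (a b : ℕ) : bitSeries (clMul a b) = bitSeries a * bitSeries b :=
  bitSeries_clMulAux _ _ _ Nat.lt_log2_self

/-! ### Concatenation of a word and a sequence -/

/-- The word `w` followed by the sequence `h`. -/
def appendSeq {R : Type*} [Zero R] (w : List R) (h : ℕ → R) (n : ℕ) : R :=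
  if n < w.length then w.getD n 0 else h (n - w.length)

theorem appendSeq_nil {R : Type*} [Zero R] (h : ℕ → R) : appendSeq [] h = h := by
  funext n
  simp [appendSeq]

theorem appendSeq_append {R : Type*} [Zero R] (u v : List R) (h : ℕ → R) :
    appendSeq (u ++ v) h = appendSeq u (appendSeq v h) := by
  funext n
  simp only [appendSeq, List.length_append]
  rcases lt_or_ge n u.length with h1 | h1
  · rw [if_pos (by omega), if_pos h1, List.getD_append _ _ _ _ h1]
  · rw [if_neg (not_lt.2 h1), List.getD_append_right _ _ _ _ h1]
    rcases lt_or_ge n (u.length + v.length) with h2 | h2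
    · rw [if_pos h2, if_pos (by omega)]
    · rw [if_neg (by omega), if_neg (by omega), Nat.sub_add_eq]

theorem starSeq_eq_appendSeq {R : Type*} [Zero R] (u w : List R) :
    starSeq u w = appendSeq u (starSeq [] w) := by
  funext n
  simp [starSeq, appendSeq]

theorem eq_starSeq_of_eq_appendSeq {R : Type*} [Zero R] {w : List R} {h : ℕ → R}
    (hw : 0 < w.length) (hh : h = appendSeq w h) : h = starSeq [] w := by
  funext n
  induction n using Nat.strong_induction_on with
  | _ n ih =>
    rw [hh]
    simp only [appendSeq]
    split_ifs with h1
    · simp [starSeq, Nat.mod_eq_of_lt h1]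
    · rw [ih _ (by omega)]
      simp [starSeq, ← Nat.mod_eq_sub_mod (not_lt.1 h1)]

/-! ### Hankel continued fractions of quadratic power series over `F_2` -/

/-- `f` satisfies the quadratic equation `A f ^ 2 + B f = C` over `F_2`, where `s = (A, C)`
and all coefficients are encoded as natural numbers. -/
def IsRoot (B : ℕ) (s : ℕ × ℕ) (f : PowerSeries (ZMod 2)) : Prop :=
  bitSeries s.1 * f ^ 2 + bitSeries B * f = bitSeries s.2

/-- The difference of two roots is annihilated by B + A (f + g), a unit because its constant term is
B(0) = 1. -/
theorem IsRoot.unique {B : ℕ} {s : ℕ × ℕ} {f g : PowerSeries (ZMod 2)} (hB : B.testBit 0 = true)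
    (hs : s.1.testBit 0 = false) (hf : IsRoot B s f) (hg : IsRoot B s g) : f = g := by
  have h : (f - g) * (bitSeries B + bitSeries s.1 * (f + g)) = 0 := by
    unfold IsRoot at hf hg
    linear_combination hf - hg
  have hu : IsUnit (bitSeries B + bitSeries s.1 * (f + g)) := by
    rw [isUnit_iff_constantCoeff]
    simp [constantCoeff_bitSeries, hB, hs]
  exact sub_eq_zero.1 ((hu.mul_left_eq_zero).1 h)

/-- The exponent of the largest power of `2` dividing `n`, if it is less than `fuel`. -/
def lowestBit : ℕ → ℕ → ℕ
  | 0, _ => 0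
  | fuel + 1, n => bif n.testBit 0 then 0 else lowestBit fuel (n / 2) + 1

/-- The left-hand side `A x ^ k + B u + C u ^ 2` of the equation for the partial denominator `u`. -/
def denomResidue (A B C k u : ℕ) : ℕ :=
  (A <<< k) ^^^ (clMul u B ^^^ clMul u (clMul u C))

/-- The partial denominator, computed digit by digit: `denom A B C k i` is correct
modulo `x ^ (i + 1)`. -/
def denom (A B C k : ℕ) : ℕ → ℕ
  | 0 => 1
  -- Adding x^(i+1) to u changes the residue by B x^(i+1) + C x^(2i+2). Since B(0) = 1, this flips
  -- bit i + 1 and no lower bit.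
  | i + 1 => bif (denomResidue A B C k (denom A B C k i)).testBit (i + 1)
      then denom A B C k i ^^^ (1 <<< (i + 1)) else denom A B C k i

/-- `(k, u, C')` is the data of one step of the Hankel continued fraction expansion of the root
of `A f ^ 2 + B f = C`: with `C = x ^ k * C₁` one has
`x ^ (k + 2) * C' = A x ^ k + B u + C₁ u ^ 2`. -/
def IsStep (B : ℕ) (s : ℕ × ℕ) (k u C' : ℕ) : Prop :=
  s.1.testBit 0 = false ∧ (s.2 >>> k).testBit 0 = true ∧ (s.2 >>> k) <<< k = s.2 ∧
    u.testBit 0 = true ∧ u < 2 ^ (k + 2) ∧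
    C' <<< (k + 2) = denomResidue s.1 B (s.2 >>> k) k u

instance (B : ℕ) (s : ℕ × ℕ) (k u C' : ℕ) : Decidable (IsStep B s k u C') := by
  unfold IsStep
  infer_instance

/-- The series h = (B + A f) / C₁ satisfies f h = x^k and C₁ h² + B h + A x^k = 0. Since u solves
this equation modulo x^(k+2) and u(0) = h(0), u agrees with h modulo x^(k+2), and g is the quotient
of h + u by x^(k+2). -/
theorem IsRoot.exists_of_isStep {B : ℕ} {s : ℕ × ℕ} {k u C' : ℕ} {f : PowerSeries (ZMod 2)}
    (hB : B.testBit 0 = true) (hf : IsRoot B s f) (h : IsStep B s k u C') :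
    ∃ g, IsRoot B (s.2 <<< 2, C') g ∧ f * (bitSeries u + X ^ (k + 2) * g) = X ^ k := by
  obtain ⟨hA, hC₁, hC, hu, -, hE⟩ := h
  obtain ⟨A, C⟩ := s
  simp only at hA hC₁ hC hE
  set C₁ := C >>> k with hC₁'
  have hCs : bitSeries C = X ^ k * bitSeries C₁ := by rw [← hC, bitSeries_shiftLeft]
  have hEs : X ^ (k + 2) * bitSeries C' = X ^ k * bitSeries A + (bitSeries u * bitSeries B +
      bitSeries u * (bitSeries u * bitSeries C₁)) := by
    rw [← bitSeries_shiftLeft, hE]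
    simp only [denomResidue, bitSeries_xor, bitSeries_clMul, bitSeries_shiftLeft]
  have h2 : (2 : PowerSeries (ZMod 2)) = 0 := two_eq_zero_powerSeries
  have hX : (X ^ k : PowerSeries (ZMod 2)) ≠ 0 := pow_ne_zero k X_ne_zero
  have hX2 : (X ^ (k + 2) : PowerSeries (ZMod 2)) ≠ 0 := pow_ne_zero _ X_ne_zero
  have hC₁u : constantCoeff (bitSeries C₁) = 1 := by simp [constantCoeff_bitSeries, hC₁]
  have hinv : bitSeries C₁ * (bitSeries C₁)⁻¹ = 1 :=
    PowerSeries.mul_inv_cancel _ (by rw [hC₁u]; exact one_ne_zero)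
  have hinvc : constantCoeff (bitSeries C₁)⁻¹ = 1 := by
    simp [hC₁u]
  unfold IsRoot at hf
  simp only at hf
  obtain ⟨h, hh⟩ : ∃ h, h = (bitSeries B + bitSeries A * f) * (bitSeries C₁)⁻¹ := ⟨_, rfl⟩
  have hch : bitSeries C₁ * h = bitSeries B + bitSeries A * f := by
    rw [hh]
    linear_combination (bitSeries B + bitSeries A * f) * hinv
  have hfh : f * h = X ^ k := by
    rw [hh]
    linear_combination (bitSeries C₁)⁻¹ * (hf + hCs) + X ^ k * hinv
  have hh0 : constantCoeff h = 1 := by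
    rw [hh]
    simp [constantCoeff_bitSeries, hinvc, hB, hA]
  have hq : bitSeries A * X ^ k + bitSeries B * h + bitSeries C₁ * h ^ 2 = 0 := by
    linear_combination h * hch + bitSeries A * hfh + (bitSeries A * X ^ k + bitSeries B * h) * h2
  have hfac : (h + bitSeries u) * (bitSeries B + bitSeries C₁ * (h + bitSeries u)) =
      X ^ (k + 2) * bitSeries C' := by
    linear_combination hq - hEs + (-X ^ k * bitSeries A + bitSeries C₁ * h * bitSeries u) * h2
  -- The constant term is B(0) + C₁(0) (1 + 1) = 1, so all of x^(k+2) must divide the other factor h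
  -- + u.
  have hunit : IsUnit (bitSeries B + bitSeries C₁ * (h + bitSeries u)) := by
    rw [isUnit_iff_constantCoeff]
    simp [constantCoeff_bitSeries, hB, hC₁, hu, hh0, CharTwo.add_self_eq_zero]
  obtain ⟨g, hg⟩ : X ^ (k + 2) ∣ h + bitSeries u := by
    rw [← hunit.dvd_mul_right, hfac]
    exact Dvd.intro _ rfl
  refine ⟨g, ?_, ?_⟩
  · unfold IsRoot
    simp only [bitSeries_shiftLeft]
    refine mul_left_cancel₀ hX2 ?_
    rw [hCs, ← hfac, hg]
    ring
  · rw [← hg, ← hfh]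
    linear_combination f * bitSeries u * h2

/-- Over `F_2` a vanishing criterion suffices: the nonzero scalar relating two determinants need not
be computed. -/
theorem ZMod.two_eq_of_eq_zero_iff {a b : ZMod 2} (h : a = 0 ↔ b = 0) : a = b := by
  revert a b
  decide

theorem IsRoot.hankelDet_of_isStep {B : ℕ} {s : ℕ × ℕ} {k u C' : ℕ} {f : PowerSeries (ZMod 2)}
    (hB : B.testBit 0 = true) (hf : IsRoot B s f) (h : IsStep B s k u C') :
    ∃ g, IsRoot B (s.2 <<< 2, C') g ∧
      hankelDet f = appendSeq (1 :: List.replicate k 0) (hankelDet g) := by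
  obtain ⟨g, hg, hfg⟩ := hf.exists_of_isStep hB h
  refine ⟨g, hg, funext fun n => ?_⟩
  obtain ⟨-, -, -, hu, hu', -⟩ := h
  have hu0 : constantCoeff (bitSeries u) ≠ 0 := by simp [constantCoeff_bitSeries, hu]
  simp only [appendSeq, List.length_cons, List.length_replicate]
  split_ifs with hn
  · rcases n with _ | n
    · simp [hankelDet_zero]
    · have hD : IsUnit (bitSeries u + X ^ (k + 2) * g) := by
        rw [isUnit_iff_constantCoeff]
        simp [constantCoeff_bitSeries, hu]
      have hd : X ^ k ∣ f := by
        rw [← hD.dvd_mul_right, hfg]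
      rw [hankelDet_eq_zero_of_X_pow_dvd f hd n.succ_pos (by omega)]
      simp [show n < k by omega]
  · obtain ⟨m, rfl⟩ : ∃ m, n = m + (k + 1) := ⟨n - (k + 1), by omega⟩
    rw [Nat.add_sub_cancel]
    exact ZMod.two_eq_of_eq_zero_iff
      (hankelDet_eq_zero_iff_of_mul_eq hu0 (degLT_bitSeries hu') hfg m)

/-- The first `n` steps of the Hankel continued fraction expansion of the root of
`A f ^ 2 + B f = C`: the corresponding initial word of Hankel determinants and the equation
of the remainder. -/
def hankelExpand (B : ℕ) : ℕ → ℕ × ℕ → Option (List (ZMod 2) × (ℕ × ℕ))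
  | 0, s => some ([], s)
  | n + 1, s =>
    let k := lowestBit s.2 s.2
    let u := denom s.1 B (s.2 >>> k) k (k + 1)
    let C' := denomResidue s.1 B (s.2 >>> k) k u >>> (k + 2)
    -- Every step is checked here, so `lowestBit` and `denom` need no correctness proof.
    if IsStep B s k u C' then
      (hankelExpand B n (s.2 <<< 2, C')).map fun r => (1 :: (List.replicate k 0 ++ r.1), r.2)
    else none

theorem IsRoot.hankelDet_of_hankelExpand {B : ℕ} (hB : B.testBit 0 = true) {n : ℕ} {s t : ℕ × ℕ}
    {f : PowerSeries (ZMod 2)} {w : List (ZMod 2)} (hf : IsRoot B s f)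
    (h : hankelExpand B n s = some (w, t)) :
    ∃ g, IsRoot B t g ∧ hankelDet f = appendSeq w (hankelDet g) := by
  induction n generalizing s f w with
  | zero =>
    simp only [hankelExpand, Option.some.injEq, Prod.mk.injEq] at h
    obtain ⟨rfl, rfl⟩ := h
    exact ⟨f, hf, (appendSeq_nil _).symm⟩
  | succ n ih =>
    simp only [hankelExpand] at h
    split_ifs at h with hs
    rw [Option.map_eq_some_iff] at h
    obtain ⟨⟨w', t'⟩, hr, h⟩ := h
    simp only [Prod.mk.injEq] at h
    obtain ⟨rfl, rfl⟩ := h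
    obtain ⟨g, hg, hfg⟩ := hf.hankelDet_of_isStep hB hs
    obtain ⟨g', hg', hgg⟩ := ih hg hr
    exact ⟨g', hg', by rw [hfg, hgg, ← appendSeq_append, List.cons_append]⟩

/-- If the expansion is periodic, with preperiod word `u` a suffix of the period word `v ++ u`,
then the Hankel determinants form the purely periodic sequence `(u ++ v)^*`. -/
theorem IsRoot.hankelDet_eq_starSeq {B : ℕ} (hB : B.testBit 0 = true) {m n : ℕ} {s t : ℕ × ℕ}
    {f : PowerSeries (ZMod 2)} {u v : List (ZMod 2)} (ht : t.1.testBit 0 = false)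
    (huv : 0 < (u ++ v).length) (hf : IsRoot B s f) (h₁ : hankelExpand B m s = some (u, t))
    (h₂ : hankelExpand B n t = some (v ++ u, t)) : hankelDet f = starSeq [] (u ++ v) := by
  obtain ⟨g, hg, hfg⟩ := hf.hankelDet_of_hankelExpand hB h₁
  obtain ⟨g', hg', hgg⟩ := hg.hankelDet_of_hankelExpand hB h₂
  -- The state recurs, hence so does the remainder g. With H(f) = u H(g) and H(g) = v u H(g) this
  -- gives H(f) = u v H(f).
  obtain rfl := hg.unique hB ht hg'
  refine eq_starSeq_of_eq_appendSeq huv ?_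
  rw [appendSeq_append, hfg, ← appendSeq_append v, ← hgg]

theorem hankelDet_zero_series :
    hankelDet (0 : PowerSeries (ZMod 2)) = starSeq [1] [0] := by
  funext n
  rcases n with _ | n
  · simp [hankelDet_zero, starSeq]
  · rw [hankelDet_eq_zero_of_X_pow_dvd _ (dvd_zero (X ^ (n + 1))) n.succ_pos le_rfl]
    simp [starSeq, Nat.mod_one]

/-- When C = 0 the remainder is the zero series, whose determinant of order 0 is still 1; hence the
extra letter after `w`. -/
theorem IsRoot.hankelDet_of_terminates {B : ℕ} (hB : B.testBit 0 = true) {m A : ℕ} {s : ℕ × ℕ}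
    {f : PowerSeries (ZMod 2)} {w : List (ZMod 2)} (hA : A.testBit 0 = false)
    (hf : IsRoot B s f) (h : hankelExpand B m s = some (w, (A, 0))) :
    hankelDet f = starSeq (w ++ [1]) [0] := by
  obtain ⟨g, hg, hfg⟩ := hf.hankelDet_of_hankelExpand hB h
  have h0 : IsRoot B (A, 0) 0 := by simp [IsRoot, bitSeries_zero]
  obtain rfl := hg.unique hB hA h0
  rw [hfg, hankelDet_zero_series, starSeq_eq_appendSeq, starSeq_eq_appendSeq (w ++ [1]),
    appendSeq_append]

/-! ### The quadratic equation of `G a b` -/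

theorem add_pow_two_of_charTwo (f g : PowerSeries (ZMod 2)) : (f + g) ^ 2 = f ^ 2 + g ^ 2 := by
  linear_combination f * g * two_eq_zero_powerSeries

theorem gTerm_sq (a b n : ℕ) : gTerm a b n ^ 2 = gTerm a b (n + 1) := by
  have h2 := two_eq_zero_powerSeries
  have hu : (1 - X ^ (2 ^ (n + 1 + b)) : PowerSeries (ZMod 2)) ≠ 0 := fun h => by
    simpa using congrArg constantCoeff h
  refine mul_right_cancel₀ hu ?_
  rw [gTerm_mul_denom, show n + 1 + a = n + a + 1 by ring, show n + 1 + b = n + b + 1 by ring,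
    pow_succ 2, pow_succ 2, pow_mul, pow_mul, ← gTerm_mul_denom a b n]
  linear_combination gTerm a b n ^ 2 * (X ^ 2 ^ (n + b) - (X ^ 2 ^ (n + b)) ^ 2) * h2

theorem X_pow_dvd_gTerm (a b n : ℕ) : X ^ n ∣ gTerm a b n := by
  rw [X_pow_dvd_iff]
  intro m hm
  refine coeff_gTerm_eq_zero a b n m ?_
  calc m < n := hm
    _ < 2 ^ n := Nat.lt_two_pow_self
    _ ≤ 2 ^ (n + a) := Nat.pow_le_pow_right two_pos (by omega)

theorem X_pow_dvd_gSum_sub (a b N : ℕ) :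
    X ^ N ∣ gSum a b - ∑ n ∈ Finset.range N, gTerm a b n := by
  rw [X_pow_dvd_iff]
  intro m hm
  rw [map_sub, map_sum, gSum, coeff_mk, sub_eq_zero]
  refine finsum_eq_sum_of_support_subset _ fun n hn => ?_
  by_contra h
  refine hn (X_pow_dvd_iff.1 (X_pow_dvd_gTerm a b n) m ?_)
  simp at h
  omega

/-- The sum telescopes, because squaring is additive and advances the index of each summand by one.
-/
theorem sum_gTerm_sq (a b N : ℕ) :
    (∑ n ∈ Finset.range N, gTerm a b n) ^ 2 + ∑ n ∈ Finset.range N, gTerm a b n =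
      gTerm a b 0 + gTerm a b N := by
  have h2 := two_eq_zero_powerSeries
  induction N with
  | zero =>
    simp only [Finset.range_zero, Finset.sum_empty]
    linear_combination -gTerm a b 0 * h2
  | succ N ih =>
    rw [Finset.sum_range_succ, add_pow_two_of_charTwo, gTerm_sq]
    linear_combination ih + gTerm a b N * h2

theorem gSum_sq_add (a b : ℕ) : gSum a b ^ 2 + gSum a b = gTerm a b 0 := by
  have h2 := two_eq_zero_powerSeries
  rw [← sub_eq_zero]
  ext m
  obtain ⟨R, hR⟩ := X_pow_dvd_gSum_sub a b (m + 1)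
  obtain ⟨T, hT⟩ := X_pow_dvd_gTerm a b (m + 1)
  have h := sum_gTerm_sq a b (m + 1)
  refine X_pow_dvd_iff.1 (?_ : X ^ (m + 1) ∣ _) m m.lt_succ_self
  -- For S = `gSum a b` and P its partial sum, (S² + S) - (P² + P) = (S - P)(S + P + 1), and x^(m+1)
  -- divides S - P.
  refine ⟨T + R * (gSum a b + ∑ n ∈ Finset.range (m + 1), gTerm a b n + 1), ?_⟩
  linear_combination h + hT + (gSum a b + ∑ n ∈ Finset.range (m + 1), gTerm a b n + 1) * hR

theorem G_quadratic (a b : ℕ) :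
    X ^ (2 ^ a) * (1 + X ^ (2 ^ b)) * G a b ^ 2 + (1 + X ^ (2 ^ b)) * G a b = 1 := by
  have h2 := two_eq_zero_powerSeries
  have h := gSum_sq_add a b
  have ht := gTerm_mul_denom a b 0
  rw [Nat.zero_add, Nat.zero_add] at ht
  refine mul_left_cancel₀ (pow_ne_zero (2 ^ a) X_ne_zero) ?_
  rw [← X_pow_mul_G] at h
  linear_combination (1 + X ^ (2 ^ b)) * h + ht + gTerm a b 0 * X ^ (2 ^ b) * h2

/-- The encoding of the coefficient `1 + x ^ (2 ^ b)`. -/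
def linCoeff (b : ℕ) : ℕ := 1 ^^^ 1 <<< 2 ^ b

theorem isRoot_G (a b : ℕ) : IsRoot (linCoeff b) (linCoeff b <<< 2 ^ a, 1) (G a b) := by
  unfold IsRoot
  simp only [linCoeff, bitSeries_shiftLeft, bitSeries_xor, bitSeries_one, mul_one]
  exact G_quadratic a b

theorem testBit_linCoeff (b : ℕ) : (linCoeff b).testBit 0 = true := by
  rw [linCoeff, Nat.testBit_xor, Nat.testBit_shiftLeft]
  simp

/-! ### Least periods -/

/-- By Bézout some multiple of p is congruent to the gcd modulo q. The case gcd = q is separate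
because a residue modulo q is less than q. -/
theorem Function.Periodic.nat_gcd {α : Type*} {s : ℕ → α} {p q : ℕ} (hq : 0 < q)
    (h₁ : Function.Periodic s p) (h₂ : Function.Periodic s q) :
    Function.Periodic s (p.gcd q) := by
  rcases (Nat.le_of_dvd hq (Nat.gcd_dvd_right p q)).eq_or_lt with h | h
  · rwa [h]
  · obtain ⟨m, -, hm⟩ := Nat.exists_mul_mod_eq_gcd h
    intro x
    rw [← h₂.nsmul (p * m / q) (x + p.gcd q), add_assoc, smul_eq_mul, mul_comm _ q, ← hm,
      Nat.mod_add_div, mul_comm p m, ← smul_eq_mul]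
    exact h₁.nsmul m x

theorem starSeq_periodic {R : Type*} [Zero R] (w : List R) :
    Function.Periodic (starSeq [] w) w.length := fun n => by
  simp [starSeq]

/-- A period `q`, the product of the list of primes `L`, is the least one if no `q / l` with
`l ∈ L` is a period. -/
theorem isLeast_period {α : Type*} {s : ℕ → α} {q : ℕ} (h : Function.Periodic s q) (L : List ℕ)
    (hL : L.prod = q) (hp : ∀ l ∈ L, l.Prime) (h' : ∀ l ∈ L, ∃ n, s (n + q / l) ≠ s n) :
    IsLeast {p : ℕ | 0 < p ∧ Function.Periodic s p} q := by
  have hq : 0 < q := by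
    rw [← hL]
    exact List.prod_pos fun l hl => (hp l hl).pos
  refine ⟨⟨hq, h⟩, fun p ⟨hp0, hps⟩ => ?_⟩
  -- If the gcd is a proper divisor of q, it divides q / l for some prime l in `L`, making q / l a
  -- period.
  have hg := hps.nat_gcd hq h
  rcases eq_or_ne (p.gcd q) q with he | he
  · exact Nat.le_of_dvd hp0 (Nat.gcd_eq_right_iff_dvd.1 he)
  · obtain ⟨c, hc⟩ := Nat.gcd_dvd_right p q
    have hc1 : c ≠ 1 := by
      rintro rfl
      exact he (by omega)
    have hl := Nat.minFac_prime hc1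
    obtain ⟨d, hd⟩ := Nat.minFac_dvd c
    have hlL : c.minFac ∈ L :=
      mem_list_primes_of_dvd_prod hl.prime (fun l hl => (hp l hl).prime)
        (hL ▸ (Dvd.intro d hd.symm).trans (Dvd.intro_left _ hc.symm))
    obtain ⟨n, hn⟩ := h' c.minFac hlL
    have : q / c.minFac = d * p.gcd q := by
      refine Nat.div_eq_of_eq_mul_left hl.pos ?_
      nth_rewrite 1 [hc]
      nth_rewrite 1 [hd]
      ring
    exact absurd (this ▸ hg.nsmul d n) hn

/-! ### Certificates for the individual series -/

/-- The certificate: `m` steps emit the first `l` letters of `w` and reach the state (A, C), then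
`n` steps emit a rotation of `w` and return to it. -/
theorem hankelDet_G_eq_starSeq {a b : ℕ} (w : List (ZMod 2)) (m n l A C : ℕ)
    (hA : A.testBit 0 = false) (hw : 0 < w.length)
    (h₁ : hankelExpand (linCoeff b) m (linCoeff b <<< 2 ^ a, 1) = some (w.take l, (A, C)))
    (h₂ : hankelExpand (linCoeff b) n (A, C) = some (w.drop l ++ w.take l, (A, C))) :
    hankelDet (G a b) = starSeq [] w := by
  have := (isRoot_G a b).hankelDet_eq_starSeq (testBit_linCoeff b) hA
    (by rwa [List.take_append_drop]) h₁ h₂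
  rwa [List.take_append_drop] at this

theorem hankelDet_G_of_terminates {a b : ℕ} (w : List (ZMod 2)) (m A : ℕ)
    (hA : A.testBit 0 = false)
    (h : hankelExpand (linCoeff b) m (linCoeff b <<< 2 ^ a, 1) = some (w, (A, 0))) :
    hankelDet (G a b) = starSeq (w ++ [1]) [0] :=
  (isRoot_G a b).hankelDet_of_terminates (testBit_linCoeff b) hA h

theorem hankelDet_G_one_zero : hankelDet (G 1 0) = starSeq [] [1] := by
  -- The certificate returns to its state after two steps, giving the word 11, which is then
  -- shortened to 1.
  rw [hankelDet_G_eq_starSeq [1, 1] 0 2 0 12 1 rfl (by decide +kernel) (by decide +kernel)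
    (by decide +kernel)]
  funext n
  rcases Nat.mod_two_eq_zero_or_one n with h | h <;> simp [starSeq, h, Nat.mod_one]

/-- For a = 0 the initial A has bit 1 set, whereas later ones are divisible by x². The initial state
thus never recurs, and one step precedes the cycle. -/
theorem hankelDet_G_zero_three : hankelDet (G 0 3) = starSeq [] word03 :=
  hankelDet_G_eq_starSeq _ 1 30 1 4 65 rfl (by decide +kernel) (by decide +kernel)
    (by decide +kernel)

theorem hankelDet_G_zero_four : hankelDet (G 0 4) = starSeq [] word04 :=
  hankelDet_G_eq_starSeq _ 1 362 1 4 16385 rfl (by decide +kernel) (by decide +kernel)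
    (by decide +kernel)

theorem isLeast_period_hankelDet_G_zero_three :
    IsLeast {p : ℕ | 0 < p ∧ Function.Periodic (hankelDet (G 0 3)) p} 74 := by
  have h := starSeq_periodic word03
  rw [show word03.length = 74 by decide +kernel] at h
  rw [hankelDet_G_zero_three]
  refine isLeast_period h [2, 37] rfl (by norm_num) ?_
  simp only [List.mem_cons, List.not_mem_nil, or_false, forall_eq_or_imp, forall_eq]
  exact ⟨⟨1, by decide +kernel⟩, ⟨3, by decide +kernel⟩⟩

theorem isLeast_period_hankelDet_G_zero_four :
    IsLeast {p : ℕ | 0 < p ∧ Function.Periodic (hankelDet (G 0 4)) p} 1078 := by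
  have h := starSeq_periodic word04
  rw [show word04.length = 1078 by decide +kernel] at h
  rw [hankelDet_G_zero_four]
  -- The shifts to exclude are 1078/2 = 539, 1078/7 = 154 (listed twice, as 7² divides 1078) and
  -- 1078/11 = 98.
  refine isLeast_period h [2, 7, 7, 11] rfl (by norm_num) ?_
  simp only [List.mem_cons, List.not_mem_nil, or_false, forall_eq_or_imp, forall_eq]
  exact ⟨⟨1, by decide +kernel⟩, ⟨0, by decide +kernel⟩, ⟨0, by decide +kernel⟩,
    ⟨0, by decide +kernel⟩⟩

theorem corollary4p1 :
    hankelDet (G 0 0) = starSeq [] [1] ∧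
    hankelDet (G 0 1) = starSeq [1, 1] [0] ∧
    hankelDet (G 1 0) = starSeq [] [1] ∧
    hankelDet (G 0 2) = starSeq [] [1, 1, 1, 0, 0, 1, 0, 0, 1, 1] ∧
    hankelDet (G 1 1) = starSeq [] [1, 1, 0, 0, 1, 1] ∧
    hankelDet (G 2 0) = starSeq [] [1, 1, 0, 0] ∧
    hankelDet (G 0 3) = starSeq [] word03 ∧
    IsLeast {p : ℕ | 0 < p ∧ Function.Periodic (hankelDet (G 0 3)) p} 74 ∧
    hankelDet (G 1 2) = starSeq [1, 1, 1] [0] ∧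
    hankelDet (G 2 1) = starSeq [] [1, 1, 1, 1, 1, 1, 0, 0] ∧
    hankelDet (G 3 0) = starSeq [] [1, 1, 0, 0, 0, 0, 0, 0] ∧
    hankelDet (G 0 4) = starSeq [] word04 ∧
    IsLeast {p : ℕ | 0 < p ∧ Function.Periodic (hankelDet (G 0 4)) p} 1078 ∧
    hankelDet (G 1 3) = starSeq [] [1, 1, 1, 1, 1, 0, 0, 0, 0, 1, 1, 0, 0, 0, 0, 1, 1, 1, 1, 1] ∧
    hankelDet (G 2 2) = starSeq [] [1, 1, 0, 0, 0, 0, 0, 0, 1, 1, 0, 0] ∧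
    hankelDet (G 3 1) = starSeq [] [1, 1, 1, 0, 0, 0, 0, 1, 1, 1, 0, 0, 0, 0, 0, 0] ∧
    hankelDet (G 4 0) = starSeq [] [1, 1, 0, 0, 0, 0, 0, 0, 0, 0, 0, 0, 0, 0, 0, 0] :=
  ⟨hankelDet_G_eq_starSeq _ 1 1 1 4 1 rfl (by decide +kernel)
      (by decide +kernel) (by decide +kernel),
    hankelDet_G_of_terminates [1] 1 4 rfl (by decide +kernel),
    hankelDet_G_one_zero,
    hankelDet_G_eq_starSeq _ 1 6 1 4 5 rfl (by decide +kernel)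
      (by decide +kernel) (by decide +kernel),
    hankelDet_G_eq_starSeq _ 0 4 0 20 1 rfl (by decide +kernel)
      (by decide +kernel) (by decide +kernel),
    hankelDet_G_eq_starSeq _ 0 2 0 48 1 rfl (by decide +kernel)
      (by decide +kernel) (by decide +kernel),
    hankelDet_G_zero_three,
    isLeast_period_hankelDet_G_zero_three,
    hankelDet_G_of_terminates [1, 1] 2 84 rfl (by decide +kernel),
    hankelDet_G_eq_starSeq _ 0 6 0 80 1 rfl (by decide +kernel)
      (by decide +kernel) (by decide +kernel),
    hankelDet_G_eq_starSeq _ 0 2 0 768 1 rfl (by decide +kernel)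
      (by decide +kernel) (by decide +kernel),
    hankelDet_G_zero_four,
    isLeast_period_hankelDet_G_zero_four,
    hankelDet_G_eq_starSeq _ 0 12 0 1028 1 rfl (by decide +kernel)
      (by decide +kernel) (by decide +kernel),
    hankelDet_G_eq_starSeq _ 0 4 0 272 1 rfl (by decide +kernel)
      (by decide +kernel) (by decide +kernel),
    hankelDet_G_eq_starSeq _ 0 6 0 1280 1 rfl (by decide +kernel)
      (by decide +kernel) (by decide +kernel),
    hankelDet_G_eq_starSeq _ 0 2 0 196608 1 rfl (by decide +kernel)
      (by decide +kernel) (by decide +kernel)⟩
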